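/- Consider a periodic soft real-time task $\tau$ with period $T>0$, relative deadline $D>0$ and relative dismiss point $\delta\ge 0$. Its jobs $J_1,J_2,\dots$ have random execution times $C_1,C_2,\dots$; job $J_j$ is released at time $(j-1)T$, has absolute deadline $(j-1)T+D$, and is dismissed at time $(j-1)T+D+\delta$ if it is not finished by then. The jobs are served first-come-first-serve by a greedy processing component whose accumulative service $\beta_j(t)$ in $[(j-1)T,(j-1)T+t)$, $0\le t\le T$, satisfies $\beta_j(0)=0$, is non-decreasing in $t$, and satisfies $\beta_j(t+\varepsilon)\le\beta_j(t)+\varepsilon$ for $\varepsilon>0$, $t+\varepsilon\le T$. Let $\mathrm{DM}(j)=1$ if $J_j$ is not finished by its absolute deadline, $\mathrm{DM}(j)=0$ otherwise, and $\mathrm{DMR}_N=\frac1N\sum_{j=1}^N\mathrm{DM}(j)$. A constant $d\in\mathbb{R}$ is called the deadline miss rate of $\tau$, written $\mathrm{DMR}=d$, if $\mathbb{P}(\lim_{N\to\infty}\mathrm{DMR}_N=d)=1$. Let $X_\bullet=(X_n)_{n\ge 1}$ be a time-homogeneous Markov chain, on the same probability space, with state space $S$, an arbitrary initial distribution, and column-stochastic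 transition matrix $P=(P_{r,s})_{r,s\in S}$, where $P_{r,s}$ is the probability of moving from $s$ to $r$. Let $X_j$ indicate the state of job $J_j$, and let $S_{\mathrm{DM}}\subseteq S$ be the set of states that indicate a deadline miss, i.e. for every $j$, almost surely, $X_j\in S_{\mathrm{DM}}$ if and only if $J_j$ misses its deadline. If $S$ is finite and $X_\bullet$ is irreducible, then there is a unique stationary distribution $\pi$, i.e. a unique probability vector $\pi=(\pi_s)_{s\in S}$ with $P\pi=\pi$. Moreover, $$\mathbb{P}\Big(\lim_{N\to\infty}\mathrm{DMR}_N=\sum_{s\in S_{\mathrm{DM}}}\pi_s\Big)=1,$$ and therefore the deadline miss rate exists, is unique, and equals $\mathrm{DMR}=\sum_{s\in S_{\mathrm{DM}}}\pi_s$. -/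

import Mathlib

open MeasureTheory ProbabilityTheory Filter Topology

/-- A periodic soft real-time task: period `T`, relative deadline `D` and relative dismiss point
`δ` after a deadline miss.  No relation between `D` and `T` is assumed. -/
structure PeriodicTask where
  T : ℝ
  D : ℝ
  δ : ℝ
  T_pos : 0 < T
  D_pos : 0 < D
  δ_nonneg : 0 ≤ δ

/-- The accumulative service of a greedy processing component: `β j t` is the amount of service
provided in `[j T, j T + t)`, for `0 ≤ t ≤ T`.  Periods are numbered from `0`. -/
structure SupplyFunction (T : ℝ) where
  β : ℕ → ℝ → ℝ
  zero : ∀ j, β j 0 = 0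
  mono : ∀ j, MonotoneOn (β j) (Set.Icc 0 T)
  rate_le_one : ∀ j t ε, 0 ≤ t → 0 < ε → t + ε ≤ T → β j (t + ε) ≤ β j t + ε

namespace SupplyFunction

/-- The accumulative service provided in `[j T, j T + t)`, for any `t ≥ 0`. -/
noncomputable def service {T : ℝ} (B : SupplyFunction T) (j : ℕ) (t : ℝ) : ℝ :=
  (∑ l ∈ Finset.range ⌊t / T⌋₊, B.β (j + l) T) + B.β (j + ⌊t / T⌋₊) (t - T * ⌊t / T⌋₊)

/-- The accumulative service provided in `[0, t)`. -/
noncomputable def supplied {T : ℝ} (B : SupplyFunction T) (t : ℝ) : ℝ :=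
  B.service 0 t

end SupplyFunction

namespace PeriodicTask

/- Jobs are numbered from `0`: the job with index `j` is the `(j+1)`-st job of the task. -/

/-- The release time of the job with index `j`. -/
def release (τ : PeriodicTask) (j : ℕ) : ℝ := j * τ.T

/-- The absolute deadline of the job with index `j`. -/
def deadline (τ : PeriodicTask) (j : ℕ) : ℝ := τ.release j + τ.D

/-- The absolute dismiss point of the job with index `j`. -/
def dismissPoint (τ : PeriodicTask) (j : ℕ) : ℝ := τ.release j + τ.D + τ.δ

/-- The time at which a job with index `j` and execution time `c` leaves the system if it is at the
head of the queue from time `s` on: the first time at which it has received `c` units of service or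
its dismiss point is reached. -/
noncomputable def departureFrom (τ : PeriodicTask) (B : SupplyFunction τ.T) (j : ℕ) (c s : ℝ) : ℝ :=
  sInf {t : ℝ | s ≤ t ∧ (c ≤ B.supplied t - B.supplied s ∨ τ.dismissPoint j ≤ t)}

/-- The time from which on the job with index `j` is at the head of the first-come-first-serve
queue: it is released, and all earlier jobs are finished or dismissed.  Here `c j` is the execution
time of the job with index `j`. -/
noncomputable def headTime (τ : PeriodicTask) (B : SupplyFunction τ.T) (c : ℕ → ℝ) : ℕ → ℝ
  | 0 => τ.release 0
  | j + 1 => max (τ.release (j + 1)) (τ.departureFrom B j (c j) (headTime τ B c j))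

/-- The job with index `j` misses its deadline: it has not received its whole execution time by its
absolute deadline. -/
def Misses (τ : PeriodicTask) (B : SupplyFunction τ.T) (c : ℕ → ℝ) (j : ℕ) : Prop :=
  ¬ ∃ t, τ.headTime B c j ≤ t ∧ t ≤ τ.deadline j ∧
    c j ≤ B.supplied t - B.supplied (τ.headTime B c j)

open Classical in
/-- The deadline miss indicator (`1` for a miss, `0` otherwise) of the job with index `j`. -/
noncomputable def DM (τ : PeriodicTask) (B : SupplyFunction τ.T) (c : ℕ → ℝ) (j : ℕ) : ℝ :=
  if τ.Misses B c j then 1 else 0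

/-- The deadline miss rate of the first `N` jobs. -/
noncomputable def DMR (τ : PeriodicTask) (B : SupplyFunction τ.T) (c : ℕ → ℝ) (N : ℕ) : ℝ :=
  (1 / (N : ℝ)) * ∑ j ∈ Finset.range N, τ.DM B c j

/-- The constant `d` is the deadline miss rate of the task: the deadline miss rate of the first `N`
jobs converges to `d` almost surely.  `B ω` and `C j ω` are the supply and the execution time of the
job with index `j` in the outcome `ω`. -/
def IsDeadlineMissRate {Ω : Type*} [MeasurableSpace Ω] (μ : Measure Ω) (τ : PeriodicTask)
    (B : Ω → SupplyFunction τ.T) (C : ℕ → Ω → ℝ) (d : ℝ) : Prop :=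
  ∀ᵐ ω ∂μ, Tendsto (fun N => τ.DMR (B ω) (fun j => C j ω) N) atTop (𝓝 d)

end PeriodicTask

/-- `X` is a (time-homogeneous) Markov chain with finite state space `S`, initial distribution `lam`
and column-stochastic transition matrix `P`: the entry `P r s` is the probability of a transition
from `s` to `r`.  `X n` is the state of the chain at the `(n+1)`-st step. -/
structure IsMarkovChain {Ω S : Type*} [MeasurableSpace Ω] [Fintype S] [DecidableEq S]
    [MeasurableSpace S] (μ : Measure Ω) (X : ℕ → Ω → S) (lam : S → ℝ) (P : Matrix S S ℝ) :
    Prop where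
  stochastic : P ∈ Matrix.colStochastic ℝ S
  measurable : ∀ n, Measurable (X n)
  initial : ∀ s, μ.real (X 0 ⁻¹' {s}) = lam s
  transition : ∀ n r s, μ (X n ⁻¹' {s}) ≠ 0 →
    (cond μ (X n ⁻¹' {s})).real (X (n + 1) ⁻¹' {r}) = P r s
  markov : ∀ n (s : ℕ → S), μ (⋂ i ∈ Set.Iic n, X i ⁻¹' {s i}) ≠ 0 →
    (cond μ (⋂ i ∈ Set.Iic n, X i ⁻¹' {s i})).real (X (n + 1) ⁻¹' {s (n + 1)}) =
      (cond μ (X n ⁻¹' {s n})).real (X (n + 1) ⁻¹' {s (n + 1)})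

/-- `p` is a stationary (invariant) distribution of the column-stochastic matrix `P`. -/
structure IsStationaryDistribution {S : Type*} [Fintype S] (P : Matrix S S ℝ) (p : S → ℝ) :
    Prop where
  nonneg : ∀ s, 0 ≤ p s
  sum_eq_one : ∑ s, p s = 1
  invariant : P.mulVec p = p

/-! The miss ratio is the time average of the indicator `f` of the miss states along the chain, so
an ergodic theorem suffices. Irreducibility makes harmonic functions constant (maximum principle),
so the Poisson equation `f - p ⬝ᵥ f = h - h ᵥ* P` is solvable; pairing it with a second stationary
vector also gives uniqueness. Along the chain, the centred sum of `f` is then a bounded telescoping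
term plus a sum of martingale increments `h (X (k+1)) - (h ᵥ* P) (X k)`. These are bounded and
orthogonal, so the second moment of their sum is `O(N)`; this gives almost sure convergence of the
averages along `N = (n+1)^2`, and monotonicity of the sums of `f ≥ 0` fills the gaps. Averages are
insensitive to periodicity and to the initial law. -/

section StochasticMatrix

/-! ### Stationary vectors and the Poisson equation -/

open Matrix

variable {S : Type*} [Fintype S] [DecidableEq S] {P : Matrix S S ℝ}

/-- A function that is harmonic for an irreducible stochastic matrix is constant. -/
theorem eq_of_vecMul_eq_self_of_isIrreducible (hP : P ∈ colStochastic ℝ S)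
    (hirr : P.IsIrreducible) {h : S → ℝ} (hh : h ᵥ* P = h) (r s : S) : h r = h s := by
  have : Nonempty S := ⟨r⟩
  obtain ⟨m, hm⟩ := Finite.exists_max h
  suffices H : ∀ r, h r = h m by rw [H r, H s]
  intro r
  obtain ⟨k, -, hk⟩ := (isIrreducible_iff_exists_pow_pos hirr.nonneg).1 hirr r m
  have hPk : P ^ k ∈ colStochastic ℝ S := pow_mem hP k
  have hhk : h ᵥ* P ^ k = h := by
    clear hk hPk
    induction k with
    | zero => simp
    | succ k ih => rw [pow_succ, ← vecMul_vecMul, ih, hh]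
  -- The maximum `h m` is an average of `h` with weights `(P ^ k) t m`, so `h` attains it wherever
  -- the weight is positive.
  have hsum : ∑ t, (h m - h t) * (P ^ k) t m = 0 := by
    have h1 : ∑ t, h t * (P ^ k) t m = h m := congrFun hhk m
    simp only [sub_mul, Finset.sum_sub_distrib]
    rw [h1, ← Finset.mul_sum, sum_col_of_mem_colStochastic hPk, mul_one, sub_self]
  have hzero := (Finset.sum_eq_zero_iff_of_nonneg (fun t _ =>
    mul_nonneg (sub_nonneg.2 (hm t)) (nonneg_of_mem_colStochastic hPk))).1 hsum r
      (Finset.mem_univ r)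
  rcases mul_eq_zero.1 hzero with h0 | h0
  · linarith
  · exact absurd h0 hk.ne'

/-- A column-stochastic matrix has a stationary distribution. -/
theorem exists_isStationaryDistribution [Nonempty S] (hP : P ∈ colStochastic ℝ S) :
    ∃ p, IsStationaryDistribution P p := by
  have hdet : (P - 1).det = 0 := by
    refine exists_vecMul_eq_zero_iff.1 ⟨1, one_ne_zero, ?_⟩
    rw [vecMul_sub, one_vecMul_of_mem_colStochastic hP, vecMul_one, sub_self]
  obtain ⟨v, hv0, hv⟩ := exists_mulVec_eq_zero_iff.2 hdet
  rw [sub_mulVec, one_mulVec, sub_eq_zero] at hv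
  have hle : ∀ s ∈ Finset.univ, |v s| ≤ (P *ᵥ fun t => |v t|) s := by
    intro s _
    calc |v s| = |∑ t, P s t * v t| := congrArg abs (congrFun hv s).symm
      _ ≤ ∑ t, |P s t * v t| := Finset.abs_sum_le_sum_abs _ _
      _ = ∑ t, P s t * |v t| := Finset.sum_congr rfl fun t _ => by
          rw [abs_mul, abs_of_nonneg (nonneg_of_mem_colStochastic hP)]
  -- `P` preserves total mass, so the entrywise bound `|v| ≤ P |v|` is an equality, and `|v|` can be
  -- normalised.
  have heq := (Finset.sum_eq_sum_iff_of_le hle).1 (sum_mulVec_of_mem_colStochastic hP).symm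
  have hpos : 0 < ∑ t, |v t| := by
    obtain ⟨t, ht⟩ := Function.ne_iff.1 hv0
    exact Finset.sum_pos' (fun t _ => abs_nonneg _) ⟨t, Finset.mem_univ t, abs_pos.2 ht⟩
  refine ⟨(∑ t, |v t|)⁻¹ • fun t => |v t|, fun s => ?_, ?_, ?_⟩
  · exact mul_nonneg (inv_nonneg.2 hpos.le) (abs_nonneg _)
  · simp only [Pi.smul_apply, smul_eq_mul, ← Finset.mul_sum]
    exact inv_mul_cancel₀ hpos.ne'
  · rw [mulVec_smul]
    congr 1
    funext s
    exact (heq s (Finset.mem_univ s)).symm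

/-- The Poisson equation of an irreducible stochastic matrix is solvable. -/
theorem IsStationaryDistribution.exists_poisson (hP : P ∈ colStochastic ℝ S)
    (hirr : P.IsIrreducible) {p : S → ℝ} (hp : IsStationaryDistribution P p) (g : S → ℝ) :
    ∃ h : S → ℝ, ∀ s, g s - p ⬝ᵥ g = h s - (h ᵥ* P) s := by
  have hpP : ∀ h : S → ℝ, p ⬝ᵥ (h ᵥ* P) = p ⬝ᵥ h := fun h => by
    rw [dotProduct_comm, ← dotProduct_mulVec, hp.invariant, dotProduct_comm]
  have hp1 : p ⬝ᵥ 1 = 1 := by rw [dotProduct_one, hp.sum_eq_one]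
  -- The rank-one term removes the constants from the kernel of `h ↦ h - h ᵥ* P`. Since `L`
  -- preserves the `p`-mean, solving `L h = g` centres `g` automatically.
  let L : (S → ℝ) →ₗ[ℝ] (S → ℝ) :=
    { toFun := fun h => h - h ᵥ* P + (p ⬝ᵥ h) • 1
      map_add' := fun x y => by
        rw [add_vecMul, dotProduct_add, add_smul]; abel
      map_smul' := fun c x => by
        rw [smul_vecMul, dotProduct_smul, smul_assoc, RingHom.id_apply, smul_add, smul_sub] }
  have hL : ∀ h, p ⬝ᵥ L h = p ⬝ᵥ h := fun h => by
    change p ⬝ᵥ (h - h ᵥ* P + (p ⬝ᵥ h) • 1) = _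
    rw [dotProduct_add, dotProduct_sub, hpP, dotProduct_smul, hp1]
    simp
  have hinj : Function.Injective L := by
    rw [← LinearMap.ker_eq_bot, LinearMap.ker_eq_bot']
    intro h hh
    have h0 : p ⬝ᵥ h = 0 := by rw [← hL, hh, dotProduct_zero]
    have hharm : h ᵥ* P = h := by
      have : h - h ᵥ* P + (p ⬝ᵥ h) • 1 = 0 := hh
      rw [h0, zero_smul, add_zero, sub_eq_zero] at this
      exact this.symm
    funext s
    have : h = h s • 1 := by
      funext r
      simpa using eq_of_vecMul_eq_self_of_isIrreducible hP hirr hharm r s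
    rw [this, dotProduct_smul, hp1] at h0
    simpa using h0
  obtain ⟨h, rfl⟩ := LinearMap.surjective_of_injective hinj g
  refine ⟨h, fun s => ?_⟩
  rw [hL]
  change (h - h ᵥ* P + (p ⬝ᵥ h) • 1) s - _ = _
  simp

/-- An irreducible stochastic matrix has at most one stationary distribution. -/
theorem IsStationaryDistribution.eq_of_isIrreducible (hP : P ∈ colStochastic ℝ S)
    (hirr : P.IsIrreducible) {p q : S → ℝ} (hp : IsStationaryDistribution P p)
    (hq : IsStationaryDistribution P q) : q = p := by
  funext s
  obtain ⟨h, hh⟩ := hp.exists_poisson hP hirr (Pi.single s 1)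
  have h1 : q ⬝ᵥ (h - h ᵥ* P) = 0 := by
    rw [dotProduct_sub, dotProduct_comm q (h ᵥ* P), ← dotProduct_mulVec, hq.invariant,
      dotProduct_comm, sub_self]
  have h2 : h - h ᵥ* P = Pi.single s 1 - (p ⬝ᵥ Pi.single s 1) • 1 := by
    funext t
    simpa using (hh t).symm
  rw [h2, dotProduct_sub, dotProduct_smul, dotProduct_one, hq.sum_eq_one] at h1
  simp at h1
  linarith

end StochasticMatrix

/-- If the second moments of a sequence of random variables are summable, the sequence converges to
`0` almost surely. -/
theorem ae_tendsto_zero_of_summable_integral_sq {Ω : Type*} [MeasurableSpace Ω] {μ : Measure Ω}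
    {Y : ℕ → Ω → ℝ} (hY : ∀ n, Measurable (Y n)) (hint : ∀ n, Integrable (fun ω => Y n ω ^ 2) μ)
    (hsum : Summable fun n => ∫ ω, Y n ω ^ 2 ∂μ) :
    ∀ᵐ ω ∂μ, Tendsto (fun n => Y n ω) atTop (𝓝 0) := by
  have hmeas : ∀ n, Measurable fun ω => ENNReal.ofReal (Y n ω ^ 2) := fun n =>
    ((hY n).pow_const 2).ennreal_ofReal
  have hfin : ∫⁻ ω, ∑' n, ENNReal.ofReal (Y n ω ^ 2) ∂μ ≠ ⊤ := by
    rw [lintegral_tsum fun n => (hmeas n).aemeasurable]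
    simp_rw [← ofReal_integral_eq_lintegral_ofReal (hint _) (ae_of_all _ fun ω => sq_nonneg _)]
    exact hsum.tsum_ofReal_ne_top
  filter_upwards [ae_lt_top (Measurable.tsum hmeas) hfin] with ω hω
  have h1 := ENNReal.tendsto_atTop_zero_of_tsum_ne_top hω.ne
  have h2 := (ENNReal.tendsto_toReal ENNReal.zero_ne_top).comp h1
  have h3 : Tendsto (fun n => Y n ω ^ 2) atTop (𝓝 0) := by
    refine h2.congr fun n => ?_
    exact ENNReal.toReal_ofReal (sq_nonneg _)
  have h4 := h3.sqrt
  simp only [Real.sqrt_sq_eq_abs, Real.sqrt_zero] at h4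
  exact (tendsto_zero_iff_abs_tendsto_zero _).2 h4

/-! ### Martingale increments and the strong law for the chain -/

namespace IsMarkovChain

open Matrix

variable {Ω S : Type*} [MeasurableSpace Ω] {μ : Measure Ω}
  [Fintype S] [DecidableEq S] [MeasurableSpace S] [MeasurableSingletonClass S]
  {X : ℕ → Ω → S} {lam : S → ℝ} {P : Matrix S S ℝ}

theorem measurableSet_path (hX : IsMarkovChain μ X lam P) (n : ℕ) (x : ℕ → S) :
    MeasurableSet (⋂ i ∈ Set.Iic n, X i ⁻¹' {x i}) :=
  MeasurableSet.biInter (Set.to_countable _) fun i _ =>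
    hX.measurable i (measurableSet_singleton _)

/-- The Markov property in product form, which also covers paths of probability zero. -/
theorem real_path_inter [IsProbabilityMeasure μ]
    (hX : IsMarkovChain μ X lam P) (n : ℕ) (x : ℕ → S) (r : S) :
    μ.real ((⋂ i ∈ Set.Iic n, X i ⁻¹' {x i}) ∩ X (n + 1) ⁻¹' {r}) =
      P r (x n) * μ.real (⋂ i ∈ Set.Iic n, X i ⁻¹' {x i}) := by
  by_cases h0 : μ (⋂ i ∈ Set.Iic n, X i ⁻¹' {x i}) = 0
  · rw [Measure.real, Measure.real, measure_inter_null_of_null_left _ h0, h0]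
    simp
  have hsub : (⋂ i ∈ Set.Iic n, X i ⁻¹' {x i}) ⊆ X n ⁻¹' {x n} :=
    Set.biInter_subset_of_mem (Set.mem_Iic.2 le_rfl)
  have hn : μ (X n ⁻¹' {x n}) ≠ 0 := fun h => h0 (measure_mono_null hsub h)
  have hupd : (⋂ i ∈ Set.Iic n, X i ⁻¹' {Function.update x (n + 1) r i}) =
      ⋂ i ∈ Set.Iic n, X i ⁻¹' {x i} := by
    refine Set.iInter₂_congr fun i hi => ?_
    rw [Function.update_of_ne (by have := Set.mem_Iic.1 hi; omega)]
  have hm := hX.markov n (Function.update x (n + 1) r)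
  rw [hupd, Function.update_self, Function.update_of_ne (by omega)] at hm
  have hm' := (hm h0).trans (hX.transition n r (x n) hn)
  rw [Measure.real, cond_apply (hX.measurableSet_path n x), ENNReal.toReal_mul,
    ENNReal.toReal_inv] at hm'
  have hne : μ.real (⋂ i ∈ Set.Iic n, X i ⁻¹' {x i}) ≠ 0 := by
    rw [measureReal_ne_zero_iff]; exact h0
  rw [← hm', ← Measure.real, ← Measure.real, mul_comm, mul_inv_cancel_left₀ hne]

/-- The martingale increments of the function `h` along the path `x`. -/
def increment (P : Matrix S S ℝ) (h : S → ℝ) (n : ℕ) (x : ℕ → S) : ℝ :=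
  h (x (n + 1)) - (h ᵥ* P) (x n)

theorem measurable_comp (hX : IsMarkovChain μ X lam P) (h : S → ℝ) (n : ℕ) :
    Measurable fun ω => h (X n ω) :=
  (measurable_of_finite h).comp (hX.measurable n)

theorem measurable_increment (hX : IsMarkovChain μ X lam P) (h : S → ℝ) (n : ℕ) :
    Measurable fun ω => increment P h n (X · ω) :=
  (hX.measurable_comp h (n + 1)).sub (hX.measurable_comp (h ᵥ* P) n)

omit [DecidableEq S] [MeasurableSpace S] [MeasurableSingletonClass S] in
theorem exists_increment_bound (P : Matrix S S ℝ) (h : S → ℝ) :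
    ∃ c, 0 ≤ c ∧ ∀ n x, |increment P h n x| ≤ c := by
  refine ⟨∑ s, |h s| + ∑ s, |(h ᵥ* P) s|, by positivity, fun n x => ?_⟩
  refine (abs_sub _ _).trans (add_le_add ?_ ?_)
  · exact Finset.single_le_sum (f := fun s => |h s|) (fun s _ => abs_nonneg _) (Finset.mem_univ _)
  · exact Finset.single_le_sum (f := fun s => |(h ᵥ* P) s|) (fun s _ => abs_nonneg _)
      (Finset.mem_univ _)

theorem integrable_increment [IsProbabilityMeasure μ]
    (hX : IsMarkovChain μ X lam P) (h : S → ℝ) (n : ℕ) :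
    Integrable (fun ω => increment P h n (X · ω)) μ := by
  obtain ⟨c, -, hc⟩ := exists_increment_bound P h
  exact Integrable.of_bound (hX.measurable_increment h n).aestronglyMeasurable c
    (ae_of_all _ fun ω => hc n _)

theorem integrable_comp [IsProbabilityMeasure μ]
    (hX : IsMarkovChain μ X lam P) (h : S → ℝ) (n : ℕ) :
    Integrable (fun ω => h (X n ω)) μ := by
  refine Integrable.of_bound (hX.measurable_comp h n).aestronglyMeasurable (∑ s, |h s|)
    (ae_of_all _ fun ω => ?_)
  exact Finset.single_le_sum (f := fun s => |h s|) (fun s _ => abs_nonneg _) (Finset.mem_univ _)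

theorem setIntegral_increment [IsProbabilityMeasure μ]
    (hX : IsMarkovChain μ X lam P) (h : S → ℝ) (n : ℕ) (x : ℕ → S) :
    ∫ ω in ⋂ i ∈ Set.Iic n, X i ⁻¹' {x i}, increment P h n (X · ω) ∂μ = 0 := by
  set A := ⋂ i ∈ Set.Iic n, X i ⁻¹' {x i} with hA
  have hAm : MeasurableSet A := hX.measurableSet_path n x
  have h1 : ∫ ω in A, h (X (n + 1) ω) ∂μ = (h ᵥ* P) (x n) * μ.real A := by
    have hind : ∀ ω, h (X (n + 1) ω) = ∑ r, (X (n + 1) ⁻¹' {r}).indicator (fun _ => h r) ω := by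
      intro ω
      simp [Set.indicator]
    have hmr : ∀ r, MeasurableSet (X (n + 1) ⁻¹' {r}) := fun r =>
      hX.measurable (n + 1) (measurableSet_singleton r)
    simp_rw [hind]
    rw [integral_finsetSum _ fun r _ => (integrable_const _).indicator (hmr r)]
    simp_rw [integral_indicator_const _ (hmr _), measureReal_restrict_apply (hmr _),
      Set.inter_comm _ A, hA, hX.real_path_inter, smul_eq_mul]
    simp only [vecMul, dotProduct, Finset.sum_mul]
    exact Finset.sum_congr rfl fun r _ => by ring
  have h2 : ∫ ω in A, (h ᵥ* P) (X n ω) ∂μ = (h ᵥ* P) (x n) * μ.real A := by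
    rw [setIntegral_congr_fun (g := fun _ => (h ᵥ* P) (x n)) hAm, setIntegral_const, smul_eq_mul,
      mul_comm]
    intro ω hω
    have : X n ω = x n := Set.mem_iInter₂.1 hω n (Set.mem_Iic.2 le_rfl)
    simp only [this]
  simp only [increment]
  rw [integral_sub (hX.integrable_comp h _).integrableOn (hX.integrable_comp _ n).integrableOn,
    h1, h2, sub_self]

/-- The increments are orthogonal to all functions of the past of the chain. -/
theorem integral_mul_increment [IsProbabilityMeasure μ]
    (hX : IsMarkovChain μ X lam P) (h : S → ℝ) (n : ℕ)
    {F : (ℕ → S) → ℝ} (hF : DependsOn F (Set.Iic n)) :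
    ∫ ω, F (X · ω) * increment P h n (X · ω) ∂μ = 0 := by
  -- Indices wrap modulo `n + 1`; only those up to `n` matter. The finitely many cylinders `A x`
  -- partition `Ω`, and `F` is constant on each.
  let e : (Fin (n + 1) → S) → ℕ → S := fun x i => x (Fin.ofNat (n + 1) i)
  let A : (Fin (n + 1) → S) → Set Ω := fun x => ⋂ i ∈ Set.Iic n, X i ⁻¹' {e x i}
  have hAm : ∀ x, MeasurableSet (A x) := fun x => hX.measurableSet_path n (e x)
  have hAmem : ∀ x ω, ω ∈ A x ↔ (fun i : Fin (n + 1) => X i ω) = x := by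
    intro x ω
    simp only [A, e, Set.mem_iInter, Set.mem_preimage, Set.mem_singleton_iff, Set.mem_Iic]
    constructor
    · intro H
      funext i
      rw [H i (Nat.lt_succ_iff.1 i.2)]
      simp
    · rintro rfl i hi
      simp [Nat.mod_eq_of_lt (Nat.lt_succ_of_le hi)]
  have hdec : ∀ ω, F (X · ω) * increment P h n (X · ω) =
      ∑ x, F (e x) * (A x).indicator (fun ω => increment P h n (X · ω)) ω := by
    intro ω
    have hω : F (X · ω) = F (e fun i : Fin (n + 1) => X i ω) := hF fun i hi => by
      simp [e, Nat.mod_eq_of_lt (Nat.lt_succ_of_le (Set.mem_Iic.1 hi))]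
    rw [Finset.sum_eq_single (fun i : Fin (n + 1) => X i ω), hω,
      Set.indicator_of_mem ((hAmem _ ω).2 rfl)]
    · intro x _ hx
      rw [Set.indicator_of_notMem fun hm => hx ((hAmem x ω).1 hm).symm, mul_zero]
    · simp
  simp_rw [hdec]
  rw [integral_finsetSum _ fun x _ =>
    ((hX.integrable_increment h n).indicator (hAm x)).const_mul _]
  refine Finset.sum_eq_zero fun x _ => ?_
  rw [integral_const_mul, integral_indicator (hAm x), hX.setIntegral_increment h n (e x), mul_zero]

/-- The second moment of the martingale part of the chain grows at most linearly. -/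
theorem exists_integral_sq_sum_increment_le [IsProbabilityMeasure μ]
    (hX : IsMarkovChain μ X lam P) (h : S → ℝ) :
    ∃ K, ∀ N : ℕ,
      Integrable (fun ω => (∑ k ∈ Finset.range N, increment P h k (X · ω)) ^ 2) μ ∧
      ∫ ω, (∑ k ∈ Finset.range N, increment P h k (X · ω)) ^ 2 ∂μ ≤ K * N := by
  obtain ⟨c, hc0, hc⟩ := exists_increment_bound P h
  have hmeas : ∀ N, Measurable fun ω => ∑ k ∈ Finset.range N, increment P h k (X · ω) := fun N =>
    Finset.measurable_fun_sum _ fun k _ => hX.measurable_increment h k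
  have hbound : ∀ N ω, |∑ k ∈ Finset.range N, increment P h k (X · ω)| ≤ N * c := fun N ω => by
    refine (Finset.abs_sum_le_sum_abs _ _).trans ?_
    refine (Finset.sum_le_sum fun k _ => hc k (X · ω)).trans ?_
    simp
  have hint : ∀ N, Integrable
      (fun ω => (∑ k ∈ Finset.range N, increment P h k (X · ω)) ^ 2) μ := fun N => by
    refine Integrable.of_bound ((hmeas N).pow_const 2).aestronglyMeasurable ((N * c) ^ 2)
      (ae_of_all _ fun ω => ?_)
    rw [norm_pow]
    exact pow_le_pow_left₀ (norm_nonneg _) (hbound N ω) 2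
  refine ⟨c ^ 2, fun N => ⟨hint N, ?_⟩⟩
  induction N with
  | zero => simp
  | succ N ih =>
    have hcross : Integrable (fun ω => (∑ k ∈ Finset.range N, increment P h k (X · ω)) *
        increment P h N (X · ω)) μ := by
      refine Integrable.of_bound
        ((hmeas N).mul (hX.measurable_increment h N)).aestronglyMeasurable (N * c * c)
        (ae_of_all _ fun ω => ?_)
      rw [norm_mul]
      exact mul_le_mul (hbound N ω) (hc N _) (norm_nonneg _) (by positivity)
    have hzero : ∫ ω, (∑ k ∈ Finset.range N, increment P h k (X · ω)) *
        increment P h N (X · ω) ∂μ = 0 := by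
      refine hX.integral_mul_increment h N
        (F := fun x => ∑ k ∈ Finset.range N, increment P h k x) fun x y hxy => ?_
      -- The increments with `k < N` only see coordinates up to `N`.
      refine Finset.sum_congr rfl fun k hk => ?_
      have hk' := Finset.mem_range.1 hk
      simp only [increment]
      rw [hxy k (Set.mem_Iic.2 hk'.le), hxy (k + 1) (Set.mem_Iic.2 hk')]
    calc ∫ ω, (∑ k ∈ Finset.range (N + 1), increment P h k (X · ω)) ^ 2 ∂μ
        ≤ ∫ ω, ((∑ k ∈ Finset.range N, increment P h k (X · ω)) ^ 2 +
            2 * ((∑ k ∈ Finset.range N, increment P h k (X · ω)) *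
              increment P h N (X · ω))) + c ^ 2 ∂μ := by
          refine integral_mono (hint (N + 1))
            (((hint N).add (hcross.const_mul 2)).add (integrable_const _)) fun ω => ?_
          have hsq : increment P h N (X · ω) ^ 2 ≤ c ^ 2 :=
            sq_le_sq' (neg_le_of_abs_le (hc N _)) (le_of_abs_le (hc N _))
          simp only [Finset.sum_range_succ]
          nlinarith
      _ = ∫ ω, (∑ k ∈ Finset.range N, increment P h k (X · ω)) ^ 2 ∂μ + c ^ 2 := by
          rw [integral_add (f := fun ω =>
              (∑ k ∈ Finset.range N, increment P h k (X · ω)) ^ 2 +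
                2 * ((∑ k ∈ Finset.range N, increment P h k (X · ω)) * increment P h N (X · ω)))
              ((hint N).add (hcross.const_mul 2)) (integrable_const _),
            integral_add (hint N) (hcross.const_mul 2), integral_const_mul, hzero]
          simp
      _ ≤ c ^ 2 * (N + 1 : ℕ) := by push_cast; linarith

/-- The average over `N` terms has second moment at most `K / N`, which is summable along squares.
The shift to `n + 1` avoids `N = 0`. -/
theorem ae_tendsto_sum_increment_div [IsProbabilityMeasure μ]
    (hX : IsMarkovChain μ X lam P) (h : S → ℝ) :
    ∀ᵐ ω ∂μ, Tendsto (fun n : ℕ =>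
      (∑ k ∈ Finset.range ((n + 1) ^ 2), increment P h k (X · ω)) / (((n + 1) ^ 2 : ℕ) : ℝ))
      atTop (𝓝 0) := by
  obtain ⟨K, hK⟩ := hX.exists_integral_sq_sum_increment_le h
  refine ae_tendsto_zero_of_summable_integral_sq (fun n => ?_) (fun n => ?_) ?_
  · exact (Finset.measurable_fun_sum _ fun k _ => hX.measurable_increment h k).div_const _
  · simp_rw [div_pow]
    exact (hK _).1.div_const _
  · have hs : Summable fun n : ℕ => K * (1 / ((n + 1 : ℕ) : ℝ) ^ 2) :=
      ((summable_nat_add_iff 1).2 (Real.summable_one_div_nat_pow.2 one_lt_two)).mul_left K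
    refine Summable.of_nonneg_of_le (fun n => integral_nonneg fun ω => sq_nonneg _) (fun n => ?_) hs
    simp_rw [div_pow]
    rw [integral_div, div_le_iff₀ (by positivity)]
    refine (hK _).2.trans_eq ?_
    push_cast
    field_simp

/-- The strong law of large numbers for nonnegative functions of an irreducible finite Markov
chain. -/
theorem ae_tendsto_average [IsProbabilityMeasure μ]
    (hX : IsMarkovChain μ X lam P) (hirr : P.IsIrreducible) {p : S → ℝ}
    (hp : IsStationaryDistribution P p) {f : S → ℝ} (hf : 0 ≤ f) :
    ∀ᵐ ω ∂μ, Tendsto (fun N : ℕ => (∑ k ∈ Finset.range N, f (X k ω)) / N) atTop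
      (𝓝 (p ⬝ᵥ f)) := by
  obtain ⟨h, hh⟩ := hp.exists_poisson hX.stochastic hirr f
  filter_upwards [hX.ae_tendsto_sum_increment_div h] with ω hω
  -- Consecutive squares have ratio tending to `1`, so for monotone sums convergence along squares
  -- suffices.
  refine tendsto_div_of_monotone_of_exists_subseq_tendsto_div _ _ ?_ fun a ha =>
    ⟨fun n => (n + 1) ^ 2, ?_, ?_, ?_⟩
  · exact monotone_nat_of_le_succ fun n => by
      rw [Finset.sum_range_succ]; exact le_add_of_nonneg_right (hf _)
  · have h1 : Tendsto (fun n : ℕ => (1 + 1 / ((n : ℝ) + 1)) ^ 2) atTop (𝓝 ((1 + 0) ^ 2)) :=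
      (tendsto_const_nhds.add tendsto_one_div_add_atTop_nhds_zero_nat).pow 2
    filter_upwards [h1.eventually_le_const (by simpa using ha)] with n hn
    have hn1 : (0 : ℝ) < n + 1 := by positivity
    have h2 : (1 + 1 / ((n : ℝ) + 1)) ^ 2 * (n + 1) ^ 2 = (n + 1 + 1) ^ 2 := by
      field_simp
    push_cast
    rw [← h2]
    exact mul_le_mul_of_nonneg_right hn (by positivity)
  · exact (tendsto_pow_atTop two_ne_zero).comp (tendsto_add_atTop_nat 1)
  · have hsq : Tendsto (fun n : ℕ => (((n + 1) ^ 2 : ℕ) : ℝ)) atTop atTop :=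
      tendsto_natCast_atTop_atTop.comp
        ((tendsto_pow_atTop two_ne_zero).comp (tendsto_add_atTop_nat 1))
    have hbd : Tendsto (fun n : ℕ =>
        (h (X 0 ω) - h (X ((n + 1) ^ 2) ω)) / (((n + 1) ^ 2 : ℕ) : ℝ)) atTop (𝓝 0) := by
      refine squeeze_zero_norm (fun n => ?_) (hsq.const_div_atTop (2 * ∑ s, |h s|))
      have hle : ∀ s, |h s| ≤ ∑ s, |h s| := fun s =>
        Finset.single_le_sum (f := fun s => |h s|) (fun s _ => abs_nonneg _) (Finset.mem_univ s)
      rw [norm_div, Real.norm_natCast]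
      refine div_le_div_of_nonneg_right ?_ (Nat.cast_nonneg _)
      exact (abs_sub _ _).trans (by linarith [hle (X 0 ω), hle (X ((n + 1) ^ 2) ω)])
    have hlim := (hbd.add hω).add_const (p ⬝ᵥ f)
    rw [add_zero, zero_add] at hlim
    refine hlim.congr fun n => ?_
    beta_reduce
    have hpos : (((n + 1) ^ 2 : ℕ) : ℝ) ≠ 0 := by positivity
    generalize (n + 1) ^ 2 = N at hpos ⊢
    -- Adding and subtracting `h (X (k + 1) ω)` in the Poisson equation splits each term into a
    -- telescoping difference and an increment.
    have hsum : ∑ k ∈ Finset.range N, f (X k ω) =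
        (h (X 0 ω) - h (X N ω)) + ∑ k ∈ Finset.range N, increment P h k (X · ω) +
          N * p ⬝ᵥ f := by
      rw [← Finset.sum_range_sub' (fun k => h (X k ω)), ← Finset.sum_add_distrib,
        ← nsmul_eq_mul, ← Finset.card_range N, ← Finset.sum_const, Finset.card_range,
        ← Finset.sum_add_distrib]
      refine Finset.sum_congr rfl fun k _ => ?_
      simp only [increment]
      linarith [hh (X k ω)]
    rw [hsum]
    field_simp

end IsMarkovChain

/-! ### The deadline miss rate -/

theorem corollary1 {Ω S : Type*} [MeasurableSpace Ω] (μ : Measure Ω) [IsProbabilityMeasure μ]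
    [Fintype S] [DecidableEq S] [MeasurableSpace S] [MeasurableSingletonClass S]
    (τ : PeriodicTask) (B : Ω → SupplyFunction τ.T) (C : ℕ → Ω → ℝ)
    (X : ℕ → Ω → S) (lam : S → ℝ) (P : Matrix S S ℝ)
    (hX : IsMarkovChain μ X lam P) (hP : P.IsIrreducible)
    (SDM : Finset S)
    (hSDM : ∀ j, ∀ᵐ ω ∂μ, X j ω ∈ SDM ↔ τ.Misses (B ω) (fun i => C i ω) j) :
    ∃ p : S → ℝ, IsStationaryDistribution P p ∧
      (∀ q : S → ℝ, IsStationaryDistribution P q → q = p) ∧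
      (∀ᵐ ω ∂μ, Tendsto (fun N => τ.DMR (B ω) (fun j => C j ω) N) atTop (𝓝 (∑ s ∈ SDM, p s))) ∧
      (∀ d : ℝ, τ.IsDeadlineMissRate μ B C d ↔ d = ∑ s ∈ SDM, p s) := by
  classical
  have : Nonempty Ω := nonempty_of_isProbabilityMeasure μ
  have : Nonempty S := this.map (X 0)
  obtain ⟨p, hp⟩ := exists_isStationaryDistribution hX.stochastic
  have hlim : ∀ᵐ ω ∂μ,
      Tendsto (fun N => τ.DMR (B ω) (fun j => C j ω) N) atTop (𝓝 (∑ s ∈ SDM, p s)) := by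
    have hf : (0 : S → ℝ) ≤ fun s => if s ∈ SDM then 1 else 0 := fun s => by
      dsimp only [Pi.zero_apply]; split_ifs <;> norm_num
    filter_upwards [hX.ae_tendsto_average hP hp hf, ae_all_iff.2 hSDM] with ω h1 h2
    have hval : p ⬝ᵥ (fun s => if s ∈ SDM then (1 : ℝ) else 0) = ∑ s ∈ SDM, p s := by
      simp [dotProduct]
    rw [hval] at h1
    refine h1.congr fun N => ?_
    rw [PeriodicTask.DMR, div_eq_mul_one_div, mul_comm]
    congr 1
    refine Finset.sum_congr rfl fun j _ => ?_
    simp only [PeriodicTask.DM, h2 j]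
  refine ⟨p, hp, fun q hq => hp.eq_of_isIrreducible hX.stochastic hP hq, hlim, fun d => ?_⟩
  constructor
  · intro hd
    -- Two almost sure events share an outcome, where the limit is unique.
    obtain ⟨ω, h1, h2⟩ := (hd.and hlim).exists
    exact tendsto_nhds_unique h1 h2
  · rintro rfl
    exact hlim
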